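/- Let $a<b$ be real numbers, $0<\alpha<1$, and let $B$ be a function with $B(\alpha)>0$. For $u\in H^1(a,b)$, with weak derivative $u'$, let $$({}^{ABC}{}_{a}D^{\alpha}u)(t)=\frac{B(\alpha)}{1-\alpha}\int_a^t E_\alpha\!\left[-\frac{\alpha}{1-\alpha}(t-s)^\alpha\right]u'(s)\,ds,\qquad E_\alpha(z)=\sum_{k=0}^\infty \frac{z^k}{\Gamma(\alpha k+1)},$$ be the left Caputo fractional derivative with Mittag-Leffler non-singular kernel. Let $p$ be continuous on $[a,b]$ with $p(t)>0$ for all $t\in[a,b]$, and let $g:[a,b]\to\mathbb R$. Suppose that $u\in H^1(a,b)$, identified with its continuous representative on $[a,b]$, satisfies $$({}^{ABC}{}_{a}D^{\alpha}u)(t)+p(t)\,u(t)=g(t)\qquad\text{for all } t\in(a,b).$$ Then $|g/p|$ is bounded on $[a,b]$ and $$\max_{t\in[a,b]}|u(t)|\le \sup_{t\in[a,b]}\left|\frac{g(t)}{p(t)}\right| ,$$ where the supremum is a maximum if $g$ is continuous on $[a,b]$. -/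

import Mathlib

open Set MeasureTheory
open scoped ContDiff

/-- The (one-parameter) Mittag-Leffler function `E_α(z) = ∑ z ^ k / Γ(α k + 1)`, real argument. -/
noncomputable def mittagLeffler (α z : ℝ) : ℝ :=
  ∑' k : ℕ, z ^ k / Real.Gamma (α * k + 1)

/-- `v` is a weak derivative of `u` on the open interval `(a, b)`: both are locally integrable there
and `∫ u φ' = - ∫ v φ` for every smooth `φ` with compact support inside `(a, b)`. -/
def IsWeakDerivOn (a b : ℝ) (u v : ℝ → ℝ) : Prop :=
  LocallyIntegrableOn u (Ioo a b) ∧ LocallyIntegrableOn v (Ioo a b) ∧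
    ∀ φ : ℝ → ℝ, ContDiff ℝ ∞ φ → HasCompactSupport φ → tsupport φ ⊆ Ioo a b →
      ∫ t in Ioo a b, u t * deriv φ t = -∫ t in Ioo a b, v t * φ t

/-- The Sobolev space `H¹(a, b)`: `u ∈ L²(a, b)` with a weak derivative in `L²(a, b)`. -/
def MemH1 (a b : ℝ) (u : ℝ → ℝ) : Prop :=
  MemLp u 2 (volume.restrict (Ioo a b)) ∧
    ∃ v : ℝ → ℝ, IsWeakDerivOn a b u v ∧ MemLp v 2 (volume.restrict (Ioo a b))

open Classical in
/-- The weak derivative of `u` on `(a, b)`; it is determined up to equality almost everywhere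
on `(a, b)` (and it is `0` by convention if `u` has no weak derivative there). -/
noncomputable def weakDerivOn (a b : ℝ) (u : ℝ → ℝ) : ℝ → ℝ :=
  if h : ∃ v : ℝ → ℝ, IsWeakDerivOn a b u v then h.choose else 0

/-- The left Caputo fractional derivative with Mittag-Leffler non-singular kernel, of order `α`
and with normalization function `B`, of `u ∈ H¹(a, b)` at the point `t ∈ [a, b]`:
`B(α) / (1 - α) * ∫ₐᵗ E_α(-(α / (1 - α)) (t - s) ^ α) u'(s) ds`, with `u'` the weak derivative. -/
noncomputable def abcDeriv (B : ℝ → ℝ) (α a b : ℝ) (u : ℝ → ℝ) (t : ℝ) : ℝ :=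
  B α / (1 - α) *
    ∫ s in a..t, mittagLeffler α (-(α / (1 - α)) * (t - s) ^ α) * weakDerivOn a b u s

/-! The heart is that `E_α(-x)` is nonnegative and decreasing for `x ≥ 0`, so the kernel has values
in `[0, 1]` and increases with `s`. Let `u` attain its maximum over `[a, c]` at `c`. Then every `∫ₛᶜ
u' = u(c) - u(s)` is nonnegative, and a layer-cake decomposition of the kernel makes the fractional
derivative at `c` nonnegative. The equation then gives `p(c) u(c) ≤ g(c)`. The same argument for
`-u` bounds `|u|`.

For the monotonicity, start from `exp(-x)`. Multiplying the `k`-th coefficient by `(αk + m + 1)/(k +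
m + 1)` replaces `f(x)` by a convex combination of `f(x)` and an average of `f(sx)` over `s ∈ [0,
1]`, which preserves sign and monotonicity. By Euler's limit for `Γ`, iterating over `m` and
rescaling `x` by `n^(1-α)` yields `E_α(-x)` as `n → ∞`. -/

open Filter Topology

/-! ### Sign and monotonicity of the Mittag-Leffler function on the negative axis -/

/-- The power series with coefficients `c` converges absolutely on `[0, ∞)`, and its sum is
nonnegative and antitone there. -/
def HasNonnegAntitoneSum (c : ℕ → ℝ) : Prop :=
  (∀ x : ℝ, 0 ≤ x → Summable fun k : ℕ => |c k| * x ^ k) ∧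
    AntitoneOn (fun x : ℝ => ∑' k : ℕ, c k * x ^ k) (Ici 0) ∧
    ∀ x : ℝ, 0 ≤ x → 0 ≤ ∑' k : ℕ, c k * x ^ k

theorem HasNonnegAntitoneSum.summable {c : ℕ → ℝ} (h : HasNonnegAntitoneSum c) {x : ℝ}
    (hx : 0 ≤ x) : Summable fun k : ℕ => c k * x ^ k := by
  refine Summable.of_norm ((h.1 x hx).congr fun k => ?_)
  rw [Real.norm_eq_abs, abs_mul, abs_of_nonneg (pow_nonneg hx k)]

theorem hasNonnegAntitoneSum_exp_neg :
    HasNonnegAntitoneSum fun k => (-1 : ℝ) ^ k / (k.factorial : ℝ) := by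
  have key : ∀ x : ℝ, ∑' k : ℕ, (-1 : ℝ) ^ k / (k.factorial : ℝ) * x ^ k = Real.exp (-x) := by
    intro x
    rw [Real.exp_eq_exp_ℝ, NormedSpace.exp_eq_tsum_div]
    refine tsum_congr fun k => ?_
    rw [neg_pow x]; ring
  refine ⟨fun x hx => ?_, ?_, fun x _ => ?_⟩
  · refine (Real.summable_pow_div_factorial x).congr fun k => ?_
    rw [abs_div, abs_pow, abs_neg, abs_one, one_pow, Nat.abs_cast]; ring
  · simp only [key]
    intro x _ y _ hxy
    exact Real.exp_le_exp.2 (neg_le_neg hxy)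
  · rw [key]; exact (Real.exp_pos _).le

/-- Averaging `f` against the law with moments `(m + 1) / (k + m + 1)`. -/
theorem HasNonnegAntitoneSum.average {c : ℕ → ℝ} (h : HasNonnegAntitoneSum c) (m : ℕ) {α : ℝ}
    (h0 : 0 ≤ α) (h1 : α ≤ 1) :
    HasNonnegAntitoneSum fun k => c k * ((α * k + (m + 1)) / (k + (m + 1))) := by
  set f : ℝ → ℝ := fun x => ∑' k : ℕ, c k * x ^ k with hf
  have hfsum : ∀ x : ℝ, 0 ≤ x → HasSum (fun k : ℕ => c k * x ^ k) (f x) :=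
    fun x hx => (h.summable hx).hasSum
  have hcoef : ∀ k : ℕ, 0 ≤ (α * k + (m + 1)) / ((k : ℝ) + (m + 1)) ∧
      (α * k + (m + 1)) / ((k : ℝ) + (m + 1)) ≤ 1 := by
    intro k
    refine ⟨by positivity, div_le_one_of_le₀ ?_ (by positivity)⟩
    nlinarith [(Nat.cast_nonneg k : (0 : ℝ) ≤ k)]
  have habs : ∀ x : ℝ, 0 ≤ x → Summable fun k : ℕ =>
      |c k * ((α * k + (m + 1)) / (k + (m + 1)))| * x ^ k := by
    intro x hx
    refine Summable.of_nonneg_of_le (fun k => by positivity) (fun k => ?_) (h.1 x hx)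
    rw [abs_mul, abs_of_nonneg (hcoef k).1]
    gcongr
    exact mul_le_of_le_one_right (abs_nonneg _) (hcoef k).2
  have hanti : ∀ x : ℝ, 0 ≤ x → AntitoneOn (fun s => f (s * x)) (uIcc (0 : ℝ) 1) := by
    intro x hx s hs t ht hst
    rw [uIcc_of_le zero_le_one] at hs ht
    exact h.2.1 (mul_nonneg hs.1 hx) (mul_nonneg ht.1 hx) (mul_le_mul_of_nonneg_right hst hx)
  have hint : ∀ x : ℝ, 0 ≤ x →
      IntervalIntegrable (fun s : ℝ => ((m + 1) * s ^ m) * f (s * x)) volume 0 1 := fun x hx =>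
    (hanti x hx).intervalIntegrable.continuousOn_mul (by fun_prop)
  have hI : ∀ x : ℝ, 0 ≤ x →
      HasSum (fun k : ℕ => c k * x ^ k * ((m + 1) / (k + (m + 1))))
        (∫ s in (0 : ℝ)..1, ((m + 1) * s ^ m) * f (s * x)) := by
    intro x hx
    have hterm : ∀ k : ℕ, ∫ s in (0 : ℝ)..1, ((m + 1) * s ^ m) * (c k * (s * x) ^ k) =
        c k * x ^ k * ((m + 1) / (k + (m + 1))) := by
      intro k
      have : ∀ s : ℝ, ((m + 1) * s ^ m) * (c k * (s * x) ^ k) =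
          ((m + 1) * (c k * x ^ k)) * s ^ (m + k) := fun s => by rw [mul_pow, pow_add]; ring
      simp only [this]
      rw [intervalIntegral.integral_const_mul, integral_pow]
      push_cast
      have : (m : ℝ) + k + 1 ≠ 0 := by positivity
      have : (k : ℝ) + (m + 1) ≠ 0 := by positivity
      simp
      field_simp
      ring
    simp only [← hterm]
    refine intervalIntegral.hasSum_integral_of_dominated_convergence
      (fun k _ => (m + 1) * (|c k| * x ^ k)) (fun k => ?_) (fun k => ?_) ?_ ?_ ?_
    · exact Continuous.aestronglyMeasurable (by fun_prop)
    · refine ae_of_all _ fun s hs => ?_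
      rw [uIoc_of_le zero_le_one] at hs
      have hs0 := hs.1.le
      rw [Real.norm_eq_abs, abs_mul, abs_mul (c k),
        abs_of_nonneg (by positivity : (0 : ℝ) ≤ (m + 1) * s ^ m),
        abs_of_nonneg (by positivity : (0 : ℝ) ≤ (s * x) ^ k)]
      have e1 : s ^ m ≤ 1 := pow_le_one₀ hs0 hs.2
      have e2 : (s * x) ^ k ≤ x ^ k :=
        pow_le_pow_left₀ (by positivity) (mul_le_of_le_one_left hx hs.2) k
      have e3 : ((m : ℝ) + 1) * s ^ m ≤ m + 1 := mul_le_of_le_one_right (by positivity) e1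
      gcongr
    · exact ae_of_all _ fun s _ => (h.1 x hx).mul_left _
    · exact intervalIntegrable_const
    · refine ae_of_all _ fun s hs => ?_
      rw [uIoc_of_le zero_le_one] at hs
      exact (hfsum _ (mul_nonneg hs.1.le hx)).mul_left _
  -- Since `αk + m + 1 = α(k + m + 1) + (1 - α)(m + 1)`, the new factor is `α + (1 - α)(m + 1)/(k +
  -- m + 1)`, and the last quotient is the `k`-th moment of the density `(m + 1)s^m`.
  have hsum : ∀ x : ℝ, 0 ≤ x →
      ∑' k : ℕ, c k * ((α * k + (m + 1)) / (k + (m + 1))) * x ^ k =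
        α * f x + (1 - α) * ∫ s in (0 : ℝ)..1, ((m + 1) * s ^ m) * f (s * x) := by
    intro x hx
    refine (((hfsum x hx).mul_left α |>.add ((hI x hx).mul_left (1 - α))).congr_fun ?_).tsum_eq
    intro k
    have : (k : ℝ) + (m + 1) ≠ 0 := by positivity
    field_simp
    ring
  refine ⟨habs, ?_, ?_⟩
  · intro x hx y hy hxy
    simp only [hsum x hx, hsum y hy]
    refine add_le_add (mul_le_mul_of_nonneg_left (h.2.1 hx hy hxy) h0)
      (mul_le_mul_of_nonneg_left ?_ (by linarith))
    refine intervalIntegral.integral_mono_on zero_le_one (hint y hy) (hint x hx) fun s hs => ?_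
    have hs0 := hs.1
    exact mul_le_mul_of_nonneg_left (h.2.1 (mul_nonneg hs.1 hx) (mul_nonneg hs.1 hy)
      (mul_le_mul_of_nonneg_left hxy hs.1)) (by positivity)
  · intro x hx
    rw [hsum x hx]
    refine add_nonneg (mul_nonneg h0 (h.2.2 x hx)) (mul_nonneg (by linarith) ?_)
    refine intervalIntegral.integral_nonneg zero_le_one fun s hs => ?_
    have hs0 := hs.1
    exact mul_nonneg (by positivity) (h.2.2 _ (mul_nonneg hs.1 hx))

theorem hasNonnegAntitoneSum_prod {α : ℝ} (h0 : 0 ≤ α) (h1 : α ≤ 1) (n : ℕ) :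
    HasNonnegAntitoneSum fun k => (-1 : ℝ) ^ k / (k.factorial : ℝ) *
      ∏ j ∈ Finset.range n, ((α * k + (j + 1)) / (k + (j + 1))) := by
  induction n with
  | zero => simpa using hasNonnegAntitoneSum_exp_neg
  | succ n ih =>
    have := ih.average n h0 h1
    simp only [Finset.prod_range_succ, ← mul_assoc]
    exact this

/-- The left side is nonincreasing in `n`: with `y = (1 - α)k` and `N = k + n + 1`, one step
multiplies it by `(1 - y/N)(1 + 1/N)^y ≤ exp(-y/N) exp(y/N) = 1`. This gives a bound uniform in `n`
for dominated convergence. -/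
theorem prod_mul_rpow_le {α : ℝ} (h0 : 0 ≤ α) (h1 : α ≤ 1) (k n : ℕ) :
    (∏ j ∈ Finset.range n, ((α * k + (j + 1)) / ((k : ℝ) + (j + 1)))) *
      ((k : ℝ) + n + 1) ^ ((1 - α) * k) ≤ ((k : ℝ) + 1) ^ ((1 - α) * k) := by
  induction n with
  | zero => simp
  | succ n ih =>
    refine le_trans ?_ ih
    rw [Finset.prod_range_succ, mul_assoc]
    refine mul_le_mul_of_nonneg_left ?_ (Finset.prod_nonneg fun j _ => by positivity)
    set y : ℝ := (1 - α) * k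
    have hy : 0 ≤ y := mul_nonneg (by linarith) (Nat.cast_nonneg k)
    set N : ℝ := (k : ℝ) + n + 1 with hN
    have hNpos : 0 < N := by positivity
    have e1 : (α * k + ((n : ℝ) + 1)) / ((k : ℝ) + (n + 1)) = 1 - y / N := by
      rw [show (k : ℝ) + (n + 1) = N by rw [hN]; ring]
      field_simp
      simp only [y, hN]; ring
    have e2 : (k : ℝ) + ((n + 1 : ℕ) : ℝ) + 1 = N * (1 + 1 / N) := by
      push_cast; field_simp; rw [hN]; ring
    have e3 : (1 + 1 / N) ^ y ≤ Real.exp (y / N) := by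
      calc (1 + 1 / N) ^ y ≤ (Real.exp (1 / N)) ^ y :=
            Real.rpow_le_rpow (by positivity) (by linarith [Real.add_one_le_exp (1 / N)]) hy
        _ = Real.exp (y / N) := by rw [← Real.exp_mul]; congr 1; ring
    have e4 : 1 - y / N ≤ Real.exp (-(y / N)) := by linarith [Real.add_one_le_exp (-(y / N))]
    rw [e1, e2, Real.mul_rpow hNpos.le (by positivity)]
    calc (1 - y / N) * (N ^ y * (1 + 1 / N) ^ y)
        ≤ Real.exp (-(y / N)) * (N ^ y * (1 + 1 / N) ^ y) :=
          mul_le_mul_of_nonneg_right e4 (by positivity)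
      _ ≤ Real.exp (-(y / N)) * (N ^ y * Real.exp (y / N)) := by gcongr
      _ = N ^ y := by
          rw [mul_left_comm, ← Real.exp_add, neg_add_cancel, Real.exp_zero, mul_one]

/-- From `(k + 1)^k / k! ≤ exp(k + 1)`, the term is at most `e · (x e (k + 1)^(-α))^k`, and the base
tends to `0` because `α > 0`. -/
theorem summable_pow_mul_rpow_div_factorial {α : ℝ} (h0 : 0 < α) {x : ℝ} (hx : 0 ≤ x) :
    Summable fun k : ℕ => x ^ k * ((k : ℝ) + 1) ^ ((1 - α) * k) / (k.factorial : ℝ) := by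
  have hlim : Tendsto (fun k : ℕ => x * Real.exp 1 * ((k : ℝ) + 1) ^ (-α)) atTop (𝓝 0) := by
    have := ((tendsto_rpow_neg_atTop h0).comp
      (tendsto_atTop_add_const_right _ (1 : ℝ) tendsto_natCast_atTop_atTop)).const_mul
        (x * Real.exp 1)
    simpa using this
  have hev : ∀ᶠ k : ℕ in atTop, x * Real.exp 1 * ((k : ℝ) + 1) ^ (-α) ≤ 1 / 2 :=
    hlim.eventually_le_const (by norm_num)
  refine Summable.of_norm_bounded_eventually_nat
    (g := fun k : ℕ => Real.exp 1 * (1 / 2 : ℝ) ^ k)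
    ((summable_geometric_of_lt_one (by norm_num) (by norm_num)).mul_left _) ?_
  filter_upwards [hev] with k hk
  have hk1 : (0 : ℝ) < (k : ℝ) + 1 := by positivity
  rw [Real.norm_eq_abs, abs_of_nonneg (by positivity)]
  have e1 : ((k : ℝ) + 1) ^ k / (k.factorial : ℝ) ≤ Real.exp ((k : ℝ) + 1) :=
    Real.pow_div_factorial_le_exp _ hk1.le k
  have e2 : ((k : ℝ) + 1) ^ ((1 - α) * k) = ((k : ℝ) + 1) ^ k * (((k : ℝ) + 1) ^ (-α)) ^ k := by
    rw [← Real.rpow_natCast, ← Real.rpow_natCast, ← Real.rpow_mul hk1.le, ← Real.rpow_add hk1]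
    congr 1; ring
  calc x ^ k * ((k : ℝ) + 1) ^ ((1 - α) * k) / (k.factorial : ℝ)
      = x ^ k * (((k : ℝ) + 1) ^ (-α)) ^ k * (((k : ℝ) + 1) ^ k / (k.factorial : ℝ)) := by
        rw [e2]; ring
    _ ≤ x ^ k * (((k : ℝ) + 1) ^ (-α)) ^ k * Real.exp ((k : ℝ) + 1) := by gcongr
    _ = Real.exp 1 * (x * Real.exp 1 * ((k : ℝ) + 1) ^ (-α)) ^ k := by
        rw [Real.exp_add, mul_pow, mul_pow, ← Real.exp_nat_mul, mul_one]; ring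
    _ ≤ Real.exp 1 * (1 / 2 : ℝ) ^ k := by gcongr

/-- Euler's limit formula for the quotient `Γ(k + 1) / Γ(α k + 1)`. -/
theorem tendsto_rpow_mul_prod_div_factorial {α : ℝ} (h0 : 0 < α) (k : ℕ) :
    Tendsto (fun n : ℕ => ((n : ℝ) ^ (1 - α)) ^ k / (k.factorial : ℝ) *
      ∏ j ∈ Finset.range (n + 1), ((α * k + (j + 1)) / ((k : ℝ) + (j + 1)))) atTop
      (𝓝 (1 / Real.Gamma (α * k + 1))) := by
  have hpos : 0 < Real.Gamma (α * k + 1) := Real.Gamma_pos_of_pos (by positivity)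
  have hk : (k.factorial : ℝ) ≠ 0 := by positivity
  have hl := (((Real.GammaSeq_tendsto_Gamma ((k : ℝ) + 1)).div
    (Real.GammaSeq_tendsto_Gamma (α * k + 1)) hpos.ne').div_const (k.factorial : ℝ))
  rw [Real.Gamma_nat_eq_factorial, div_right_comm, div_self hk] at hl
  refine hl.congr' ?_
  filter_upwards [eventually_gt_atTop 0] with n hn
  have hn' : (0 : ℝ) < n := by exact_mod_cast hn
  have e1 : (n : ℝ) ^ ((k : ℝ) + 1) = (n : ℝ) ^ (α * k + 1) * ((n : ℝ) ^ (1 - α)) ^ k := by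
    rw [← Real.rpow_natCast, ← Real.rpow_mul hn'.le, ← Real.rpow_add hn']
    congr 1; ring
  have e2 : ∀ y : ℝ, ∏ j ∈ Finset.range (n + 1), (y + 1 + (j : ℝ)) =
      ∏ j ∈ Finset.range (n + 1), (y + ((j : ℝ) + 1)) :=
    fun y => Finset.prod_congr rfl fun j _ => by ring
  have p1 : (∏ j ∈ Finset.range (n + 1), (α * k + ((j : ℝ) + 1))) ≠ 0 :=
    (Finset.prod_pos fun j _ => by positivity).ne'
  have p2 : (∏ j ∈ Finset.range (n + 1), ((k : ℝ) + ((j : ℝ) + 1))) ≠ 0 :=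
    (Finset.prod_pos fun j _ => by positivity).ne'
  have p3 : (n.factorial : ℝ) ≠ 0 := by positivity
  have p4 : (n : ℝ) ^ (α * k + 1) ≠ 0 := (Real.rpow_pos_of_pos hn' _).ne'
  simp only [Pi.div_apply, Real.GammaSeq]
  rw [Finset.prod_div_distrib, e2, e2, e1]
  field_simp

/-- Dominated convergence: rescaling the argument by `n^(1-α)` supplies the power of `n` in Euler's
formula, and being a positive dilation it preserves sign and monotonicity. -/
theorem tendsto_tsum_mittagLeffler_neg {α : ℝ} (h0 : 0 < α) (h1 : α ≤ 1) {x : ℝ} (hx : 0 ≤ x) :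
    Tendsto (fun n : ℕ => ∑' k : ℕ, (-1 : ℝ) ^ k / (k.factorial : ℝ) *
      (∏ j ∈ Finset.range (n + 1), ((α * k + (j + 1)) / ((k : ℝ) + (j + 1)))) *
        ((n : ℝ) ^ (1 - α) * x) ^ k) atTop (𝓝 (mittagLeffler α (-x))) := by
  refine tendsto_tsum_of_dominated_convergence (summable_pow_mul_rpow_div_factorial h0 hx)
    (fun k => ?_) (Eventually.of_forall fun n k => ?_)
  · have := (tendsto_rpow_mul_prod_div_factorial h0 k).const_mul ((-x) ^ k)
    rw [mul_one_div] at this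
    refine this.congr fun n => ?_
    rw [neg_pow, mul_pow]; ring
  · have hP : 0 ≤ ∏ j ∈ Finset.range (n + 1), ((α * k + (j + 1)) / ((k : ℝ) + (j + 1))) :=
      Finset.prod_nonneg fun j _ => by positivity
    rw [norm_mul, norm_mul, norm_div, norm_pow, norm_neg, norm_one, one_pow,
      Real.norm_of_nonneg hP, Real.norm_of_nonneg (by positivity), Real.norm_of_nonneg (by positivity)]
    have e1 : ((n : ℝ) ^ (1 - α)) ^ k ≤ ((k : ℝ) + (n + 1 : ℕ) + 1) ^ ((1 - α) * k) := by
      rw [← Real.rpow_natCast, ← Real.rpow_mul (Nat.cast_nonneg n)]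
      refine Real.rpow_le_rpow (Nat.cast_nonneg n) ?_
        (mul_nonneg (by linarith) (Nat.cast_nonneg k))
      push_cast
      linarith [(Nat.cast_nonneg k : (0 : ℝ) ≤ k)]
    have e2 := (mul_le_mul_of_nonneg_left e1 hP).trans (prod_mul_rpow_le h0.le h1 k (n + 1))
    rw [mul_pow]
    calc _ = x ^ k / (k.factorial : ℝ) *
          ((∏ j ∈ Finset.range (n + 1), ((α * k + (j + 1)) / ((k : ℝ) + (j + 1)))) *
            ((n : ℝ) ^ (1 - α)) ^ k) := by ring
      _ ≤ x ^ k / (k.factorial : ℝ) * ((k : ℝ) + 1) ^ ((1 - α) * k) := by gcongr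
      _ = _ := by ring

theorem mittagLeffler_neg_nonneg {α : ℝ} (h0 : 0 < α) (h1 : α ≤ 1) {x : ℝ} (hx : 0 ≤ x) :
    0 ≤ mittagLeffler α (-x) :=
  ge_of_tendsto' (tendsto_tsum_mittagLeffler_neg h0 h1 hx) fun n =>
    (hasNonnegAntitoneSum_prod h0.le h1 (n + 1)).2.2 _ (by positivity)

theorem antitoneOn_mittagLeffler_neg {α : ℝ} (h0 : 0 < α) (h1 : α ≤ 1) :
    AntitoneOn (fun x => mittagLeffler α (-x)) (Ici 0) := fun _ hx _ hy hxy =>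
  le_of_tendsto_of_tendsto' (tendsto_tsum_mittagLeffler_neg h0 h1 hy)
    (tendsto_tsum_mittagLeffler_neg h0 h1 hx) fun n =>
      (hasNonnegAntitoneSum_prod h0.le h1 (n + 1)).2.1
        (mul_nonneg (Real.rpow_nonneg n.cast_nonneg _) hx)
        (mul_nonneg (Real.rpow_nonneg n.cast_nonneg _) hy)
        (mul_le_mul_of_nonneg_left hxy (Real.rpow_nonneg n.cast_nonneg _))

theorem mittagLeffler_zero (α : ℝ) : mittagLeffler α 0 = 1 := by
  rw [mittagLeffler, tsum_eq_single 0 fun k hk => by simp [hk]]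
  simp

theorem mittagLeffler_neg_le_one {α : ℝ} (h0 : 0 < α) (h1 : α ≤ 1) {x : ℝ} (hx : 0 ≤ x) :
    mittagLeffler α (-x) ≤ 1 := by
  have := antitoneOn_mittagLeffler_neg h0 h1 (mem_Ici.2 le_rfl) hx hx
  simpa [mittagLeffler_zero] using this

/-! ### Integration against a monotone weight -/

/-- If all integrals of `v` over final segments `(s, t)` are nonnegative, so is the integral of `v`
against a monotone weight with values in `[0, 1]`. -/
theorem integral_monotone_mul_nonneg {a t : ℝ} (hat : a ≤ t) {k v : ℝ → ℝ} (hk : Monotone k)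
    (hk0 : ∀ s, 0 ≤ k s) (hk1 : ∀ s, k s ≤ 1) (hv : IntervalIntegrable v volume a t)
    (h : ∀ s ∈ Icc a t, 0 ≤ ∫ r in s..t, v r) : 0 ≤ ∫ s in a..t, k s * v s := by
  set S : Set (ℝ × ℝ) := {q | q.2 < k q.1} with hS
  have hSm : MeasurableSet S := measurableSet_lt measurable_snd (hk.measurable.comp measurable_fst)
  set F : ℝ → ℝ → ℝ := fun s y => S.indicator (fun q => v q.1) (s, y) with hF
  have hvI : Integrable v (volume.restrict (Ioc a t)) :=
    (intervalIntegrable_iff_integrableOn_Ioc_of_le hat).1 hv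
  have hFint : Integrable (Function.uncurry F)
      ((volume.restrict (Ioc a t)).prod (volume.restrict (Ioc (0 : ℝ) 1))) := by
    have : Function.uncurry F = S.indicator (fun q => v q.1) := rfl
    rw [this]
    exact (hvI.comp_fst _).indicator hSm
  -- Layer cake: `k s` is the length of the set of `y ∈ (0, 1]` with `y < k s`, as `0 ≤ k s ≤ 1`.
  have hlayer : ∀ s, k s * v s = ∫ y in Ioc (0 : ℝ) 1, F s y := by
    intro s
    have : F s = (Iio (k s)).indicator fun _ => v s := by
      ext y
      simp [F, S, indicator]
    rw [this, setIntegral_indicator measurableSet_Iio, setIntegral_const, smul_eq_mul,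
      measureReal_def, show Ioc (0 : ℝ) 1 ∩ Iio (k s) = Ioo 0 (k s) from ?_, Real.volume_Ioo,
      ENNReal.toReal_ofReal (by linarith [hk0 s]), sub_zero]
    ext y
    simp only [mem_inter_iff, mem_Ioc, mem_Iio, mem_Ioo]
    exact ⟨fun h => ⟨h.1.1, h.2⟩, fun h => ⟨⟨h.1, h.2.le.trans (hk1 s)⟩, h.2⟩⟩
  rw [intervalIntegral.integral_of_le hat]
  simp only [hlayer]
  rw [integral_integral_swap hFint]
  refine integral_nonneg fun y => ?_
  have hy : (fun s => F s y) = {s | y < k s}.indicator v := by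
    ext s
    simp [F, S, indicator]
  have hym : MeasurableSet {s | y < k s} := measurableSet_lt measurable_const hk.measurable
  simp only [Pi.zero_apply, hy]
  rw [setIntegral_indicator hym]
  by_cases hne : (Ioc a t ∩ {s | y < k s}).Nonempty
  swap
  · rw [not_nonempty_iff_eq_empty.1 hne]; simp
  set c := sInf (Ioc a t ∩ {s | y < k s}) with hc
  have hbdd : BddBelow (Ioc a t ∩ {s | y < k s}) := ⟨a, fun s hs => hs.1.1.le⟩
  have hac : a ≤ c := le_csInf hne fun s hs => hs.1.1.le
  have hct : c ≤ t := by
    obtain ⟨s, hs⟩ := hne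
    exact (csInf_le hbdd hs).trans hs.1.2
  -- A superlevel set of a monotone function is a final segment; whether it contains its left end
  -- `c` is irrelevant to the integral.
  have hae : (Ioc a t ∩ {s | y < k s} : Set ℝ) =ᵐ[volume] Ioc c t := by
    have h1 : (Ioc a t ∩ {s | y < k s} : Set ℝ) ⊆ Icc c t := fun s hs => ⟨csInf_le hbdd hs, hs.1.2⟩
    have h2 : Ioc c t ⊆ Ioc a t ∩ {s | y < k s} := by
      intro s hs
      obtain ⟨r, hr, hrs⟩ := exists_lt_of_csInf_lt hne hs.1
      exact ⟨⟨hac.trans_lt hs.1, hs.2⟩, lt_of_lt_of_le hr.2 (hk hrs.le)⟩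
    exact (h1.eventuallyLE.trans Ioc_ae_eq_Icc.symm.le).antisymm h2.eventuallyLE
  rw [setIntegral_congr_set hae, ← intervalIntegral.integral_of_le hct]
  exact h c ⟨hac, hct⟩

/-! ### Weak derivatives and the fundamental theorem of calculus -/

theorem MeasureTheory.LocallyIntegrableOn.integrable_mul_of_tsupport_subset {U : Set ℝ}
    {f φ : ℝ → ℝ} (hf : LocallyIntegrableOn f U) (hφ : Continuous φ) (hφc : HasCompactSupport φ)
    (hφs : tsupport φ ⊆ U) : Integrable (fun x => f x * φ x) (volume.restrict U) := by
  have h1 : IntegrableOn (fun x => f x * φ x) (tsupport φ) :=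
    (hf.integrableOn_compact_subset hφs hφc).mul_continuousOn hφ.continuousOn hφc
  refine Integrable.restrict ((integrableOn_iff_integrable_of_support_subset ?_).1 h1)
  exact (Function.support_mul_subset_right _ _).trans (subset_tsupport φ)

theorem IsWeakDerivOn.ae_eq {a b : ℝ} {u v w : ℝ → ℝ} (hv : IsWeakDerivOn a b u v)
    (hw : IsWeakDerivOn a b u w) : ∀ᵐ x, x ∈ Ioo a b → v x = w x := by
  have key := isOpen_Ioo.ae_eq_zero_of_integral_contDiff_smul_eq_zero
    (hv.2.1.sub hw.2.1) (μ := volume) fun φ hφ hφc hφs => ?_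
  · filter_upwards [key] with x hx hxm
    exact sub_eq_zero.1 (hx hxm)
  · have h1 := hv.2.2 φ hφ hφc hφs
    rw [hw.2.2 φ hφ hφc hφs, neg_inj] at h1
    rw [← setIntegral_eq_integral_of_forall_compl_eq_zero (s := Ioo a b)]
    · simp only [Pi.sub_apply, smul_eq_mul, mul_comm (φ _), sub_mul]
      rw [integral_sub (hv.2.1.integrable_mul_of_tsupport_subset hφ.continuous hφc hφs) 
        (hw.2.1.integrable_mul_of_tsupport_subset hφ.continuous hφc hφs),
        h1, sub_self]
    · intro x hx
      rw [image_eq_zero_of_notMem_tsupport fun h => hx (hφs h), zero_smul]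

/-- Integration by parts against a test function, for a primitive of an integrable function. -/
theorem integral_primitive_mul_deriv {a b : ℝ} (hab : a ≤ b) {v : ℝ → ℝ}
    (hv : IntervalIntegrable v volume a b) {φ : ℝ → ℝ} (hφ : ContDiff ℝ ∞ φ)
    (hφs : tsupport φ ⊆ Ioo a b) :
    ∫ t in Ioo a b, (∫ s in a..t, v s) * deriv φ t = -∫ t in Ioo a b, v t * φ t := by
  have hφ0 : ∀ x, x ∉ Ioo a b → φ x = 0 := fun x hx =>
    image_eq_zero_of_notMem_tsupport fun h => hx (hφs h)
  have hac := hv.absolutelyContinuousOnInterval_intervalIntegral (c := a) left_mem_uIcc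
  have hacφ : AbsolutelyContinuousOnInterval φ a b :=
    ((hφ.of_le (by exact_mod_cast le_top)).contDiffOn).absolutelyContinuousOnInterval
  have h := hac.integral_mul_deriv_eq_deriv_mul hacφ
  rw [hφ0 a (by simp), hφ0 b (by simp), mul_zero, mul_zero, sub_zero, zero_sub] at h
  rw [← integral_Ioc_eq_integral_Ioo, ← integral_Ioc_eq_integral_Ioo,
    ← intervalIntegral.integral_of_le hab, ← intervalIntegral.integral_of_le hab, h, neg_inj]
  refine intervalIntegral.integral_congr_ae ?_
  filter_upwards [hv.ae_hasDerivAt_integral] with x hx hxm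
  rw [(hx (uIoc_subset_uIcc hxm) a left_mem_uIcc).deriv]

/-- A test function with zero integral has a primitive that is a test function. -/
theorem exists_contDiff_deriv_eq {a b : ℝ} {ψ : ℝ → ℝ} (hψ : ContDiff ℝ ∞ ψ)
    (hψc : HasCompactSupport ψ) (hψs : tsupport ψ ⊆ Ioo a b) (h0 : ∫ t, ψ t = 0) :
    ∃ φ : ℝ → ℝ, ContDiff ℝ ∞ φ ∧ HasCompactSupport φ ∧ tsupport φ ⊆ Ioo a b ∧ deriv φ = ψ := by
  by_cases hne : (tsupport ψ).Nonempty
  swap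
  · have : ψ = 0 := by
      rw [← tsupport_eq_empty_iff]; exact not_nonempty_iff_eq_empty.1 hne
    exact ⟨0, contDiff_const, HasCompactSupport.zero, by simp [tsupport], by
      rw [this]; ext x; simp⟩
  -- The primitive is based at the left end `c` of the support, so it vanishes to the left of `c`;
  -- to the right of `d` it equals the total integral, which is zero.
  obtain ⟨c, hc, hcl⟩ := hψc.isCompact.exists_isLeast hne
  obtain ⟨d, hd, hdu⟩ := hψc.isCompact.exists_isGreatest hne
  have hz : ∀ x, x ∉ Icc c d → ψ x = 0 := fun x hx =>
    image_eq_zero_of_notMem_tsupport fun h => hx ⟨hcl h, hdu h⟩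
  have hder : ∀ x, HasDerivAt (fun x => ∫ t in c..x, ψ t) (ψ x) x := fun x =>
    hψ.continuous.integral_hasStrictDerivAt c x |>.hasDerivAt
  have hderiv : deriv (fun x => ∫ t in c..x, ψ t) = ψ := funext fun x => (hder x).deriv
  have hsub : Function.support (fun x => ∫ t in c..x, ψ t) ⊆ Icc c d := by
    intro x hx
    by_contra hxn
    apply hx
    rw [mem_Icc, not_and_or, not_le, not_le] at hxn
    rcases hxn with hxc | hxd
    · show ∫ t in c..x, ψ t = 0
      rw [intervalIntegral.integral_symm, intervalIntegral.integral_of_le hxc.le,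
        integral_Ioc_eq_integral_Ioo, neg_eq_zero]
      exact setIntegral_eq_zero_of_forall_eq_zero fun t ht => hz t fun h => absurd h.1 (not_le.2 ht.2)
    · show ∫ t in c..x, ψ t = 0
      have hcx : c ≤ x := (hcl hd).trans hxd.le
      rw [intervalIntegral.integral_of_le hcx, ← integral_Icc_eq_integral_Ioc,
        setIntegral_eq_integral_of_forall_compl_eq_zero, h0]
      exact fun t ht => hz t fun h => ht ⟨h.1, h.2.trans hxd.le⟩
  have hts : tsupport (fun x => ∫ t in c..x, ψ t) ⊆ Icc c d := closure_minimal hsub isClosed_Icc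
  refine ⟨_, ?_, HasCompactSupport.of_support_subset_isCompact isCompact_Icc hsub,
    hts.trans (Icc_subset_Ioo (hψs hc).1 (hψs hd).2), hderiv⟩
  rw [contDiff_infty_iff_deriv, hderiv]
  exact ⟨fun x => (hder x).differentiableAt, hψ⟩

/-- The du Bois-Reymond lemma for continuous functions. -/
theorem exists_eqOn_const_of_integral_mul_deriv_eq_zero {a b : ℝ} (hab : a < b) {w : ℝ → ℝ}
    (hw : ContinuousOn w (Icc a b))
    (h : ∀ φ : ℝ → ℝ, ContDiff ℝ ∞ φ → HasCompactSupport φ → tsupport φ ⊆ Ioo a b →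
      ∫ t in Ioo a b, w t * deriv φ t = 0) :
    ∃ c, EqOn w (fun _ => c) (Icc a b) := by
  obtain ⟨η, hηs, hηc, hη, hη1⟩ : ∃ η : ℝ → ℝ, tsupport η ⊆ Ioo a b ∧ HasCompactSupport η ∧
      ContDiff ℝ ∞ η ∧ ∫ t, η t = 1 := by
    obtain ⟨f, hf⟩ : ∃ f : ContDiffBump ((a + b) / 2), f.rOut = (b - a) / 4 :=
      ⟨⟨(b - a) / 8, (b - a) / 4, by linarith, by linarith⟩, rfl⟩
    refine ⟨f.normed volume, ?_, f.hasCompactSupport_normed, f.contDiff_normed, f.integral_normed⟩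
    rw [f.tsupport_normed_eq, hf, Real.closedBall_eq_Icc]
    exact Icc_subset_Ioo (by linarith) (by linarith)
  have hwl : LocallyIntegrableOn w (Ioo a b) :=
    (hw.mono Ioo_subset_Icc_self).locallyIntegrableOn measurableSet_Ioo
  set c : ℝ := ∫ t in Ioo a b, w t * η t with hc
  refine ⟨c, ?_⟩
  have key : ∀ᵐ x, x ∈ Ioo a b → w x - c = 0 := by
    refine isOpen_Ioo.ae_eq_zero_of_integral_contDiff_smul_eq_zero
      (hwl.sub ((locallyIntegrable_const c).locallyIntegrableOn _)) fun ψ hψ hψc hψs => ?_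
    -- Subtracting `m η` makes the mean of `ψ` zero, so `ψ - m η` is the derivative of a test
    -- function and `h` applies.
    set m : ℝ := ∫ t, ψ t with hm
    have hmη : HasCompactSupport fun t => m * η t := hηc.mul_left
    have hmηs : tsupport (fun t => m * η t) ⊆ Ioo a b :=
      (closure_mono (Function.support_mul_subset_right _ _)).trans hηs
    obtain ⟨φ, hφ, hφc, hφs, hφd⟩ := exists_contDiff_deriv_eq (a := a) (b := b)
      (hψ.sub (contDiff_const.mul hη : ContDiff ℝ ∞ fun t => m * η t)) (hψc.sub hmη)
      ((tsupport_sub _ _).trans (union_subset hψs hmηs)) (by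
        rw [integral_sub (hψ.continuous.integrable_of_hasCompactSupport hψc)
          ((hη.continuous.integrable_of_hasCompactSupport hηc).const_mul m),
          integral_const_mul, hη1, mul_one, sub_self])
    have h0 := h φ hφ hφc hφs
    have hwψ := hwl.integrable_mul_of_tsupport_subset hψ.continuous hψc hψs
    have hwη := hwl.integrable_mul_of_tsupport_subset hη.continuous hηc hηs
    have hψm : ∫ t in Ioo a b, ψ t = m := setIntegral_eq_integral_of_forall_compl_eq_zero
      fun t ht => image_eq_zero_of_notMem_tsupport fun h => ht (hψs h)
    have h1 : ∫ t in Ioo a b, w t * ψ t = m * c := by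
      have : ∀ t, w t * deriv φ t = w t * ψ t - m * (w t * η t) := fun t => by
        rw [hφd]; ring
      simp only [this] at h0
      rw [integral_sub hwψ (hwη.const_mul m), integral_const_mul] at h0
      linarith
    rw [← setIntegral_eq_integral_of_forall_compl_eq_zero (s := Ioo a b)]
    · simp only [smul_eq_mul, mul_comm (ψ _), sub_mul]
      rw [integral_sub hwψ ((hψ.continuous.integrable_of_hasCompactSupport hψc).restrict.const_mul c),
        integral_const_mul, h1, hψm]
      ring
    · intro x hx
      rw [image_eq_zero_of_notMem_tsupport fun h => hx (hψs h), zero_smul]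
  refine Measure.eqOn_Icc_of_ae_eq volume hab.ne ?_ hw continuousOn_const
  rw [← Measure.restrict_congr_set Ioo_ae_eq_Icc]
  refine (ae_restrict_iff' measurableSet_Ioo).2 ?_
  filter_upwards [key] with x hx hxm
  exact sub_eq_zero.1 (hx hxm)

/-- The fundamental theorem of calculus for the continuous representative. -/
theorem IsWeakDerivOn.integral_eq_sub {a b : ℝ} (hab : a < b) {u v : ℝ → ℝ}
    (h : IsWeakDerivOn a b u v) (hu : ContinuousOn u (Icc a b))
    (hv : IntervalIntegrable v volume a b) {s t : ℝ} (hs : s ∈ Icc a b) (ht : t ∈ Icc a b) :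
    ∫ r in s..t, v r = u t - u s := by
  have hV : ContinuousOn (fun t => ∫ r in a..t, v r) (Icc a b) := by
    have := hv.absolutelyContinuousOnInterval_intervalIntegral (c := a) left_mem_uIcc
    simpa [uIcc_of_le hab.le] using this.continuousOn
  obtain ⟨c, hc⟩ := exists_eqOn_const_of_integral_mul_deriv_eq_zero hab (hu.sub hV)
    fun φ hφ hφc hφs => by
      have hd : Continuous (deriv φ) := hφ.continuous_deriv (by exact_mod_cast le_top)
      have hds : tsupport (deriv φ) ⊆ Ioo a b := (tsupport_deriv_subset).trans hφs
      have hVl : LocallyIntegrableOn (fun t => ∫ r in a..t, v r) (Ioo a b) :=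
        (hV.mono Ioo_subset_Icc_self).locallyIntegrableOn measurableSet_Ioo
      simp only [Pi.sub_apply, sub_mul]
      rw [integral_sub (h.1.integrable_mul_of_tsupport_subset hd hφc.deriv hds)
        (hVl.integrable_mul_of_tsupport_subset hd hφc.deriv hds), h.2.2 φ hφ hφc hφs,
        integral_primitive_mul_deriv hab.le hv hφ hφs, sub_self]
  have h1 := hc hs
  have h2 := hc ht
  have hi : ∀ x ∈ Icc a b, IntervalIntegrable v volume a x := fun x hx =>
    hv.mono_set (uIcc_subset_uIcc_left (by rwa [uIcc_of_le hab.le]))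
  rw [← intervalIntegral.integral_interval_sub_left (hi t ht) (hi s hs)]
  simp only [Pi.sub_apply] at h1 h2
  linarith

/-! ### The kernel and the maximum principle -/

/-- The kernel `s ↦ E_α(-λ (t - s) ^ α)`, extended by its value at `t` to the right of `t`. -/
noncomputable def mittagLefflerKernel (α l t s : ℝ) : ℝ :=
  mittagLeffler α (-(l * max (t - s) 0 ^ α))

section Kernel

variable {α l : ℝ}

theorem mittagLefflerKernel_nonneg (h0 : 0 < α) (h1 : α ≤ 1) (hl : 0 ≤ l) (t s : ℝ) :
    0 ≤ mittagLefflerKernel α l t s :=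
  mittagLeffler_neg_nonneg h0 h1 (by positivity)

theorem mittagLefflerKernel_le_one (h0 : 0 < α) (h1 : α ≤ 1) (hl : 0 ≤ l) (t s : ℝ) :
    mittagLefflerKernel α l t s ≤ 1 :=
  mittagLeffler_neg_le_one h0 h1 (by positivity)

/-- Truncating `t - s` at `0` is what gives monotonicity on the whole line, as
`integral_monotone_mul_nonneg` requires. -/
theorem monotone_mittagLefflerKernel (h0 : 0 < α) (h1 : α ≤ 1) (hl : 0 ≤ l) (t : ℝ) :
    Monotone (mittagLefflerKernel α l t) := fun r s hrs => by
  refine antitoneOn_mittagLeffler_neg h0 h1 (mem_Ici.2 (by positivity)) (mem_Ici.2 (by positivity))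
    ?_
  gcongr

theorem integral_mittagLeffler_mul_eq {a t : ℝ} (hat : a ≤ t) (v : ℝ → ℝ) :
    ∫ s in a..t, mittagLeffler α (-l * (t - s) ^ α) * v s =
      ∫ s in a..t, mittagLefflerKernel α l t s * v s := by
  refine intervalIntegral.integral_congr fun s hs => ?_
  rw [uIcc_of_le hat] at hs
  simp only [mittagLefflerKernel]
  rw [max_eq_left (by linarith [hs.2]), neg_mul]

theorem abs_integral_mittagLeffler_mul_le (h0 : 0 < α) (h1 : α ≤ 1) (hl : 0 ≤ l) {a t : ℝ}
    (hat : a ≤ t) {v : ℝ → ℝ} (hv : IntervalIntegrable v volume a t) :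
    |∫ s in a..t, mittagLeffler α (-l * (t - s) ^ α) * v s| ≤ ∫ s in a..t, |v s| := by
  rw [integral_mittagLeffler_mul_eq hat, ← Real.norm_eq_abs]
  refine intervalIntegral.norm_integral_le_of_norm_le hat (ae_of_all _ fun s _ => ?_) hv.abs
  rw [norm_mul, Real.norm_eq_abs, Real.norm_eq_abs,
    abs_of_nonneg (mittagLefflerKernel_nonneg h0 h1 hl t s)]
  exact mul_le_of_le_one_left (abs_nonneg _) (mittagLefflerKernel_le_one h0 h1 hl t s)

theorem integral_mittagLeffler_mul_nonneg (h0 : 0 < α) (h1 : α ≤ 1) (hl : 0 ≤ l) {a t : ℝ}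
    (hat : a ≤ t) {v : ℝ → ℝ} (hv : IntervalIntegrable v volume a t)
    (h : ∀ s ∈ Icc a t, 0 ≤ ∫ r in s..t, v r) :
    0 ≤ ∫ s in a..t, mittagLeffler α (-l * (t - s) ^ α) * v s := by
  rw [integral_mittagLeffler_mul_eq hat]
  exact integral_monotone_mul_nonneg hat (monotone_mittagLefflerKernel h0 h1 hl t)
    (mittagLefflerKernel_nonneg h0 h1 hl t) (mittagLefflerKernel_le_one h0 h1 hl t) hv h

/-- One-sided maximum principle, in terms of `v = u'`. -/
theorem le_of_integral_mittagLeffler_add_mul_eq (h0 : 0 < α) (h1 : α ≤ 1) (hl : 0 ≤ l)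
    {a b C M : ℝ} (hab : a < b) (hC : 0 ≤ C) {p g u v : ℝ → ℝ} (hp : ContinuousOn p (Icc a b))
    (hp_pos : ∀ t ∈ Icc a b, 0 < p t) (hu : ContinuousOn u (Icc a b))
    (hv : IntervalIntegrable v volume a b)
    (huv : ∀ s ∈ Icc a b, ∀ t ∈ Icc a b, ∫ r in s..t, v r = u t - u s)
    (heq : ∀ t ∈ Ioo a b,
      C * (∫ s in a..t, mittagLeffler α (-l * (t - s) ^ α) * v s) + p t * u t = g t)
    (hg : ∀ t ∈ Ioo a b, g t ≤ M * p t) : ∀ t ∈ Icc a b, u t ≤ M := by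
  have hi : ∀ x ∈ Icc a b, IntervalIntegrable v volume a x := fun x hx =>
    hv.mono_set (uIcc_subset_uIcc_left (by rwa [uIcc_of_le hab.le]))
  have ha : a ∈ Icc a b := left_mem_Icc.2 hab.le
  have hV : ContinuousOn (fun t => ∫ r in a..t, |v r|) (Icc a b) := by
    have := hv.abs.absolutelyContinuousOnInterval_intervalIntegral (c := a) left_mem_uIcc
    simpa [uIcc_of_le hab.le] using this.continuousOn
  -- The equation is not assumed at `a`. Near `a` the fractional term is at most `C ∫ₐᵗ |v|`, which
  -- tends to `0`, so the bound follows by letting `t → a`.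
  have hua : u a ≤ M := by
    have h2 : p a * u a ≤ M * p a + C * ∫ r in a..a, |v r| := by
      refine le_on_closure (s := Ioo a b) (f := fun t => p t * u t)
        (g := fun t => M * p t + C * ∫ r in a..t, |v r|) (fun t ht => ?_) ?_ ?_ ?_
      · have htc := Ioo_subset_Icc_self ht
        have := abs_integral_mittagLeffler_mul_le h0 h1 hl ht.1.le (hi t htc)
        have := mul_le_mul_of_nonneg_left ((neg_le_abs _).trans this) hC
        linarith [heq t ht, hg t ht]
      all_goals rw [closure_Ioo hab.ne]
      · exact hp.mul hu
      · exact (continuousOn_const.mul hp).add (continuousOn_const.mul hV)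
      · exact ha
    rw [intervalIntegral.integral_same, mul_zero, add_zero, mul_comm M] at h2
    exact le_of_mul_le_mul_left h2 (hp_pos a ha)
  have hIco : ∀ t ∈ Ico a b, u t ≤ M := by
    intro t ht
    have hsub : Icc a t ⊆ Icc a b := Icc_subset_Icc_right ht.2.le
    -- Taking `t < b` forces the maximiser `c` to be either `a` or a point of `(a, b)`, where the
    -- equation holds. A maximum over `[a, t]` suffices because the derivative at `c` involves only
    -- `[a, c]`.
    obtain ⟨c, hc, hmax⟩ := isCompact_Icc.exists_isMaxOn (nonempty_Icc.2 ht.1) (hu.mono hsub)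
    refine (hmax (right_mem_Icc.2 ht.1) : u t ≤ u c).trans ?_
    rcases hc.1.eq_or_lt with rfl | hac
    · exact hua
    have hcm : c ∈ Ioo a b := ⟨hac, hc.2.trans_lt ht.2⟩
    have hD := integral_mittagLeffler_mul_nonneg h0 h1 hl hac.le (hi c (hsub hc)) fun s hs => by
      have hst : s ∈ Icc a t := ⟨hs.1, hs.2.trans hc.2⟩
      rw [huv s (hsub hst) c (hsub hc)]
      exact sub_nonneg.2 (hmax hst)
    have h2 : p c * u c ≤ p c * M := by
      linarith [heq c hcm, hg c hcm, mul_nonneg hC hD, mul_comm M (p c)]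
    exact le_of_mul_le_mul_left h2 (hp_pos c (hsub hc))
  intro t ht
  rw [← closure_Ico hab.ne] at ht hu
  exact le_on_closure (f := u) (g := fun _ => M) hIco hu continuousOn_const ht

end Kernel

/-! ### The estimate for `H¹` solutions -/

theorem MemH1.exists_isWeakDerivOn {a b : ℝ} {u : ℝ → ℝ} (hu : MemH1 a b u) :
    IsWeakDerivOn a b u (weakDerivOn a b u) := by
  obtain ⟨-, v, hv, -⟩ := hu
  have h : ∃ v : ℝ → ℝ, IsWeakDerivOn a b u v := ⟨v, hv⟩
  rw [weakDerivOn, dif_pos h]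
  exact h.choose_spec

/-- The chosen weak derivative is a priori only locally integrable; it agrees a.e. with the one in
`L²`, which is integrable on a bounded interval. -/
theorem MemH1.intervalIntegrable_weakDerivOn {a b : ℝ} (hab : a ≤ b) {u : ℝ → ℝ}
    (hu : MemH1 a b u) : IntervalIntegrable (weakDerivOn a b u) volume a b := by
  have hw := hu.exists_isWeakDerivOn
  obtain ⟨-, v, hv, hv2⟩ := hu
  rw [intervalIntegrable_iff_integrableOn_Ioo_of_le hab]
  refine (hv2.integrable (by norm_num)).congr ?_
  exact (ae_restrict_iff' measurableSet_Ioo).2 (hv.ae_eq hw)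

theorem lemma3p3 (B : ℝ → ℝ) (α : ℝ) (hα0 : 0 < α) (hα1 : α < 1) (hB : 0 < B α)
    (a b : ℝ) (hab : a < b) (p g u : ℝ → ℝ)
    (hp : ContinuousOn p (Icc a b)) (hp_pos : ∀ t ∈ Icc a b, 0 < p t)
    (hu : MemH1 a b u)
    -- `u` is the continuous representative of its class in `H¹(a, b)`
    (hu_cont : ContinuousOn u (Icc a b))
    (heq : ∀ t ∈ Ioo a b, abcDeriv B α a b u t + p t * u t = g t) :
    -- the supremum of `|u|` over `[a, b]` is a maximum
    IsGreatest ((fun t => |u t|) '' Icc a b) (sSup ((fun t => |u t|) '' Icc a b)) ∧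
    -- the supremum of `|g / p|` is finite, and it is a maximum if `g` is continuous
    BddAbove ((fun t => |g t / p t|) '' Icc a b) ∧
    (ContinuousOn g (Icc a b) →
      IsGreatest ((fun t => |g t / p t|) '' Icc a b)
        (sSup ((fun t => |g t / p t|) '' Icc a b))) ∧
    -- the estimate
    sSup ((fun t => |u t|) '' Icc a b) ≤ sSup ((fun t => |g t / p t|) '' Icc a b) := by
  set v := weakDerivOn a b u with hv_def
  have hv : IntervalIntegrable v volume a b := hu.intervalIntegrable_weakDerivOn hab.le
  have huv : ∀ s ∈ Icc a b, ∀ t ∈ Icc a b, ∫ r in s..t, v r = u t - u s := fun s hs t ht =>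
    hu.exists_isWeakDerivOn.integral_eq_sub hab hu_cont hv hs ht
  have hl : 0 ≤ α / (1 - α) := div_nonneg hα0.le (by linarith)
  set C := B α / (1 - α) with hC_def
  have hC : 0 ≤ C := div_nonneg hB.le (by linarith)
  have hne : (Icc a b).Nonempty := nonempty_Icc.2 hab.le
  have hD : ∀ t ∈ Ioo a b, |abcDeriv B α a b u t| ≤ C * ∫ s in a..b, |v s| := by
    intro t ht
    have hi : IntervalIntegrable v volume a t :=
      hv.mono_set (uIcc_subset_uIcc_left (by rw [uIcc_of_le hab.le]; exact Ioo_subset_Icc_self ht))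
    rw [abcDeriv, abs_mul, abs_of_nonneg hC]
    refine mul_le_mul_of_nonneg_left
      ((abs_integral_mittagLeffler_mul_le hα0 hα1.le hl ht.1.le hi).trans ?_) hC
    exact intervalIntegral.integral_mono_interval le_rfl ht.1.le ht.2.le
      (ae_of_all _ fun s => abs_nonneg _) hv.abs
  have hbdd : BddAbove ((fun t => |g t / p t|) '' Icc a b) := by
    obtain ⟨K, hK⟩ := isCompact_Icc.bddAbove_image
      (((continuousOn_const (c := C * ∫ s in a..b, |v s|)).div hp
        fun t ht => (hp_pos t ht).ne').add hu_cont.abs)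
    have hIoo : BddAbove ((fun t => |g t / p t|) '' Ioo a b) := by
      refine ⟨K, ?_⟩
      rintro _ ⟨t, ht, rfl⟩
      have htc := Ioo_subset_Icc_self ht
      have hpt := hp_pos t htc
      refine le_trans ?_ (hK (mem_image_of_mem _ htc))
      simp only [Pi.add_apply]
      rw [← heq t ht, add_div, mul_div_cancel_left₀ _ hpt.ne']
      refine (abs_add_le _ _).trans (add_le_add ?_ le_rfl)
      rw [abs_div, abs_of_pos hpt]
      exact div_le_div_of_nonneg_right (hD t ht) hpt.le
    -- The equation says nothing about `g` at `a` and `b`, but two further values cannot spoil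
    -- boundedness.
    rw [← Ioo_union_both hab.le, image_union]
    exact hIoo.union ((toFinite {a, b}).image _).bddAbove
  refine ⟨(isCompact_Icc.image_of_continuousOn hu_cont.abs).isGreatest_sSup (hne.image _), hbdd,
    fun hg => (isCompact_Icc.image_of_continuousOn
      (hg.div hp fun t ht => (hp_pos t ht).ne').abs).isGreatest_sSup (hne.image _), ?_⟩
  set M := sSup ((fun t => |g t / p t|) '' Icc a b) with hM
  have hgM : ∀ t ∈ Ioo a b, |g t| ≤ M * p t := by
    intro t ht
    have htc := Ioo_subset_Icc_self ht
    have hpt := hp_pos t htc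
    have : |g t / p t| ≤ M := le_csSup hbdd (mem_image_of_mem _ htc)
    rwa [abs_div, abs_of_pos hpt, div_le_iff₀ hpt] at this
  have hupper := le_of_integral_mittagLeffler_add_mul_eq hα0 hα1.le hl hab hC hp hp_pos hu_cont hv
    huv heq fun t ht => (le_abs_self _).trans (hgM t ht)
  -- By linearity `-u` solves the equation with right side `-g`, so the one-sided bound also
  -- controls `-u`.
  have hlower := le_of_integral_mittagLeffler_add_mul_eq (g := -g) (u := -u) (v := -v) (M := M)
    hα0 hα1.le hl hab hC hp hp_pos hu_cont.neg hv.neg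
    (fun s hs t ht => by
      simp only [Pi.neg_apply, intervalIntegral.integral_neg, huv s hs t ht]; ring)
    (fun t ht => by
      simp only [Pi.neg_apply, mul_neg, intervalIntegral.integral_neg, ← heq t ht, abcDeriv]
      ring)
    fun t ht => (neg_le_abs _).trans (hgM t ht)
  refine csSup_le (hne.image _) ?_
  rintro _ ⟨t, ht, rfl⟩
  exact abs_le'.2 ⟨hupper t ht, hlower t ht⟩
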